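/- **Setting.** Fix $b>1$, $d\in\mathbb N$, $R>0$, $G\ge 0$, $\gamma>0$, $\alpha>0$, and the feasible set $\mathcal F=[-R,R]^d$. The following algorithm (online gradient descent with randomized rounding and randomized counting) is run for $T$ rounds. It keeps a point $\hat\beta_t\in\mathcal F$, with $\hat\beta_1=0$, and for each coordinate $i$ a counter $C_i$, initially $1$. In round $t$ it plays $\hat\beta_t$; an adversary, who knows the whole history of the game so far, reveals a loss function $f_t$ that is convex on $\mathcal F$ and a subgradient $g_t$ of $f_t$ at $\hat\beta_t$ with $\|g_t\|_\infty\le G$. Coordinates $i$ with $g_{t,i}=0$ are left unchanged. For each $i$ with $g_{t,i}\neq 0$: 1. $C_i$ is increased by $1$ with probability $b^{-C_i}$ and otherwise kept; with the new value, the estimated count is $\tilde\tau_{t,i}=\frac{b^{C_i}-b}{b-1}$ and the learning rate is $\eta_{t,i}=\alpha/\sqrt{\tilde\tau_{t,i}+1}$; 2. $\beta_{t+1,i}$ is the projection of $\hat\beta_{t,i}-\eta_{t,i}g_{t,i}$ onto $[-R,R]$; 3. $\hat\beta_{t+1,i}$ is obtained from $\beta_{t+1,i}$ by unbiased randomized rounding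 to one of the two neighbouring points of the grid $\epsilon_{t,i}\mathbb Z$ (if $\beta_{t+1,i}$ is itself a grid point, it is kept). The resolution $\epsilon_{t,i}\in(0,\gamma\eta_{t,i}]$ may depend on the history, on $i$ and on the new counter value, and is always such that $-R$ and $R$ are grid points. All coin flips are made with fresh randomness. Let $\tau_{T,i}$ be the number of rounds $t\le T$ with $g_{t,i}\ne0$, and let $$\mathrm{Regret}=\sum_{t=1}^T f_t(\hat\beta_t)-\inf_{\beta\in\mathcal F}\sum_{t=1}^T f_t(\beta).$$ Expectations are over the randomness of the algorithm. **Theorem.** (i) For every $T$ and all nonnegative integers $n_1,\dots,n_d$ such that surely $\tau_{T,i}\le n_i$ for all $i$ (for example $n_i=T$), $$\mathbf E[\mathrm{Regret}]\le\sum_{i=1}^d\left(\frac{2R^2\sqrt{k_2n_i+1}}{\alpha}+(G^2+\gamma^2)\frac{\alpha\sqrt{n_i}}{\sqrt{k_1}}+\gamma R\sqrt{n_i}+4RG\sqrt{n_i}\right),$$ where, with $n=n_i$ and $c=5/2$, $k_1=\frac1{b\,c\log n}$ and $k_2=\frac{e\,b^{\sqrt{2c\log_b n}+2}}{b-1}$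 (for $n\le 1$ the second summand is read as $0$, and for $n=0$ one reads $k_2n=0$). (ii) For every $b>1$ there is a function $\varphi:\mathbb N\to\mathbb R$, depending only on $b$, with $\varphi(T)=o(T^{1/2+\delta})$ as $T\to\infty$ for every $\delta>0$, such that for all $d,R,G,\gamma,T$ as above, with the choice $\alpha=R/\sqrt{G^2+\gamma^2}$, and for all such resolutions and adversaries, $$\mathbf E[\mathrm{Regret}]\le d\,R\sqrt{G^2+\gamma^2}\;\varphi(T).$$ -/

import Mathlib

open Filter Asymptotics

noncomputable section

namespace OGDRand

/-- A biased coin: `true` with probability `p` (clamped to `[0, 1]`), `false` otherwise. -/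
def coin (p : ℝ) : PMF Bool :=
  PMF.ofFintype
    (fun c => cond c (min (ENNReal.ofReal p) 1) (1 - min (ENNReal.ofReal p) 1)) (by simp)

/-! ### The randomized counter -/

/-- One increment operation of the randomized counter with base `b`: a counter with value `C`
moves to `C + 1` with probability `b ^ (-C)` and keeps its value otherwise. -/
def counterIncrement (b : ℝ) (C : ℕ) : PMF ℕ :=
  (coin ((b ^ C)⁻¹)).map (fun c => if c then C + 1 else C)

/-- The estimated count `(b ^ C - b) / (b - 1)` of a counter with value `C`. -/
def estimatedCount (b : ℝ) (C : ℕ) : ℝ := (b ^ C - b) / (b - 1)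

/-- The learning rate `α / √(τ̃ + 1)` as a function of the counter value. -/
def learningRate (b α : ℝ) (C : ℕ) : ℝ := α / √(estimatedCount b C + 1)

/-! ### Projection and randomized rounding -/

/-- Projection of a real number onto `[-R, R]`. -/
def project (R x : ℝ) : ℝ := max (-R) (min x R)

/-- Randomized rounding of `x` to the grid `ε ℤ`: with `lo = ε ⌊x / ε⌋` and `hi = ε ⌈x / ε⌉`
the result is `hi` with probability `(x - lo) / ε` and `lo` otherwise. -/
def randomRound (x ε : ℝ) : PMF ℝ :=
  (coin ((x - ε * ⌊x / ε⌋) / ε)).map (fun c => if c then ε * ⌈x / ε⌉ else ε * ⌊x / ε⌋)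

/-! ### The algorithm -/

/-- What the algorithm stores: the current (rounded) coefficients and one counter for each
coordinate. -/
structure State (d : ℕ) where
  point : Fin d → ℝ
  counter : Fin d → ℕ

/-- Initially all coefficients are `0` and all counters are `1`. -/
def initialState (d : ℕ) : State d := ⟨fun _ => 0, fun _ => 1⟩

/-- The history at the start of a round: the states after the rounds played so far, the most
recent one first (the list is empty before the first round). -/
abbrev History (d : ℕ) := List (State d)

/-- The state at the start of the round that follows the history `h`. -/
def History.state {d : ℕ} (h : History d) : State d := h.headD (initialState d)

/-- The point that the algorithm plays in the round that follows the history `h`. -/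
def History.point {d : ℕ} (h : History d) : Fin d → ℝ := h.state.point

/-- The work of one round on coordinate `i`, with gradient coordinate `gi`. If `gi = 0` nothing
happens. Otherwise the counter of the coordinate is incremented, its new value gives the learning
rate and (through `ε`) the resolution, and the gradient step is projected and rounded. -/
def coordinateStep {d : ℕ} (b R α : ℝ) (ε : ℕ → ℝ) (gi : ℝ) (s : State d) (i : Fin d) :
    PMF (State d) :=
  if gi = 0 then PMF.pure s
  else
    (counterIncrement b (s.counter i)).bind fun C =>
      (randomRound (project R (s.point i - learningRate b α C * gi)) (ε C)).map fun x =>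
        ⟨Function.update s.point i x, Function.update s.counter i C⟩

/-- One round: the coordinates are processed one after the other, with fresh randomness. -/
def round {d : ℕ} (b R α : ℝ) (ε : History d → Fin d → ℕ → ℝ) (g : History d → Fin d → ℝ)
    (h : History d) : PMF (State d) :=
  (List.finRange d).foldlM (fun s i => coordinateStep b R α (ε h i) (g h i) s i) h.state

/-- The law of the history after `T` rounds, when the adversary answers the history `h` with a
loss whose (sub)gradient at the played point is `g h`. -/
def play {d : ℕ} (b R α : ℝ) (ε : History d → Fin d → ℕ → ℝ) (g : History d → Fin d → ℝ) :
    ℕ → PMF (History d)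
  | 0 => PMF.pure []
  | T + 1 => (play b R α ε g T).bind fun h => (round b R α ε g h).map fun s => s :: h

/-- Expectation of a real random variable under a discrete law. (All laws used below have finite
support, see `play_support_finite`, so that the sum is a finite one.) -/
def expectation {A : Type} (p : PMF A) (X : A → ℝ) : ℝ := ∑' a, (p a).toReal * X a

/-! ### Losses and regret -/

/-- The feasible set `[-R, R] ^ d`. -/
def feasible (d : ℕ) (R : ℝ) : Set (Fin d → ℝ) := {x | ∀ i, x i ∈ Set.Icc (-R) R}

/-- Total loss of the points played along a history, where `f h` is the loss function chosen by
the adversary in the round that follows the history `h`. -/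
def playedLoss {d : ℕ} (f : History d → (Fin d → ℝ) → ℝ) : History d → ℝ
  | [] => 0
  | _ :: h => f h (History.point h) + playedLoss f h

/-- Total loss of the fixed point `x` along a history. -/
def fixedLoss {d : ℕ} (f : History d → (Fin d → ℝ) → ℝ) (x : Fin d → ℝ) : History d → ℝ
  | [] => 0
  | _ :: h => f h x + fixedLoss f x h

/-- The regret with respect to the best fixed feasible point in hindsight. -/
def regret {d : ℕ} (R : ℝ) (f : History d → (Fin d → ℝ) → ℝ) (h : History d) : ℝ :=
  playedLoss f h - sInf ((fun x => fixedLoss f x h) '' feasible d R)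

/-- The number of rounds along a history in which coordinate `i` of the gradient was nonzero. -/
def nonzeroCount {d : ℕ} (g : History d → Fin d → ℝ) (i : Fin d) : History d → ℕ
  | [] => 0
  | _ :: h => (if g h i = 0 then 0 else 1) + nonzeroCount g i h

/-- An admissible resolution schedule: for every coordinate and each value that its counter can
take, a grid width in `(0, γ η]`, where `η` is the learning rate, such that `-R` and `R` are grid
points. It may also depend on the history. -/
def IsResolutionSchedule {d : ℕ} (b R γ α : ℝ) (ε : History d → Fin d → ℕ → ℝ) : Prop :=
  ∀ (h : History d) (i : Fin d) (C : ℕ), 1 ≤ C →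
    0 < ε h i C ∧ ε h i C ≤ γ * learningRate b α C ∧ ∃ k : ℤ, R = k * ε h i C

/-- A loss function `f`, convex on the feasible set, with subgradient `v` at `x` relative to the
feasible set, where the entries of `v` have absolute value at most `G`. -/
def IsAdmissibleLoss {d : ℕ} (R G : ℝ) (f : (Fin d → ℝ) → ℝ) (x v : Fin d → ℝ) : Prop :=
  ConvexOn ℝ (feasible d R) f ∧
  (∀ y ∈ feasible d R, f x + ∑ i, v i * (y i - x i) ≤ f y) ∧
  ∀ i, |v i| ≤ G

/-- An adaptive adversary, against `T` rounds of the algorithm: `f h` and `g h` are the loss and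
its subgradient at the played point, chosen with full knowledge of the history `h`. Something is
required only at histories that can occur. -/
def IsAdversary {d : ℕ} (b R G α : ℝ) (ε : History d → Fin d → ℕ → ℝ)
    (f : History d → (Fin d → ℝ) → ℝ) (g : History d → Fin d → ℝ) (T : ℕ) : Prop :=
  ∀ t < T, ∀ h ∈ (play b R α ε g t).support, IsAdmissibleLoss R G (f h) h.point (g h)

/-! ### The explicit bound -/

/-- `k₁ = 1 / (b c log n)` with `c = 5 / 2`. (For `n = 1`, where `1 / √k₁` means `0`, the
conventions for division by zero give `k₁ = 0` and `1 / √k₁ = 0`.) -/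
def kOne (b : ℝ) (n : ℕ) : ℝ := 1 / (b * (5 / 2) * Real.log n)

/-- `k₂ = e b ^ (√(2 c log_b n) + 2) / (b - 1)` with `c = 5 / 2`. -/
def kTwo (b : ℝ) (n : ℕ) : ℝ :=
  Real.exp 1 * b ^ (√(2 * (5 / 2) * Real.logb b n) + 2) / (b - 1)

/-- The explicit regret bound for a single coordinate with `n` nonzero gradients. -/
def coordinateBound (b R G γ α : ℝ) (n : ℕ) : ℝ :=
  2 * R ^ 2 * √(kTwo b n * n + 1) / α + (G ^ 2 + γ ^ 2) * (α * √n / √(kOne b n))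
    + γ * R * √n + 4 * R * G * √n

/-! ### The law of the history has finite support -/

theorem coordinateStep_support_finite {d : ℕ} (b R α : ℝ) (ε : ℕ → ℝ) (gi : ℝ) (s : State d)
    (i : Fin d) : (coordinateStep b R α ε gi s i).support.Finite := by
  unfold coordinateStep
  split_ifs
  · simp
  · rw [PMF.support_bind]
    refine Set.Finite.biUnion ?_ fun C _ => ?_
    · rw [counterIncrement, PMF.support_map]
      exact (Set.toFinite _).image _
    · rw [PMF.support_map, randomRound, PMF.support_map]
      exact ((Set.toFinite _).image _).image _

theorem foldlM_support_finite {A B : Type} (k : A → B → PMF A)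
    (hk : ∀ a x, (k a x).support.Finite) :
    ∀ (l : List B) (a : A), (l.foldlM k a).support.Finite
  | [], a => by
      change (PMF.pure a).support.Finite
      simp
  | x :: l, a => by
      change ((k a x).bind fun a' => l.foldlM k a').support.Finite
      rw [PMF.support_bind]
      exact (hk a x).biUnion fun a' _ => foldlM_support_finite k hk l a'

theorem play_support_finite {d : ℕ} (b R α : ℝ) (ε : History d → Fin d → ℕ → ℝ)
    (g : History d → Fin d → ℝ) : ∀ T, (play b R α ε g T).support.Finite
  | 0 => by simp [play]
  | T + 1 => by
      rw [play, PMF.support_bind]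
      refine (play_support_finite b R α ε g T).biUnion fun h _ => ?_
      rw [PMF.support_map]
      exact (foldlM_support_finite _
        (fun s i => coordinateStep_support_finite b R α (ε h i) (g h i) s i) _ _).image _

end OGDRand

end

namespace OGDRand

/-! ### Expectations under laws of finite support -/

/-! The subgradient inequality bounds the regret by a sum over coordinates of linearized regrets
(`playedLoss_sub_fixedLoss_le`), so one coordinate suffices. Write u = √(τ̃ + 1) for its scale, so
that η = α / u. The usual gradient descent inequality holds on every path (`linearRegret_add_le`)
and leaves three terms: 2R²/η for the final learning rate, the accumulated second order costs, and β
times the accumulated normalized rounding errors.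

The best β depends on all the coin flips, so the product of β with the rounding noise need not have
mean zero. Therefore the error term (z - y)(y - β)/η is split: the part with y has conditional mean
zero given the past and the new counter and joins the costs, while the part with β is bounded by R
times the absolute value of the noise sum.

Each of the three terms is controlled in expectation by a quantity that does not increase on average
in any round (`expectation_play_le`). First, u² minus the number of nonzero gradients is a
martingale, so E u ≤ √(n + 1) by Jensen. Secondly, the squared noise sum minus γ² times that number
is a supermartingale, so the noise sum is at most γ√n in mean absolute value. Thirdly, a step costs
at most a multiple of η = α/u on average, and an increment raises u on average by at least a
constant times 1/u (`counterScale_drift`), so the total cost is at most a constant times the growth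
of u.

No tail bounds for the counter are needed, and the result is O(√n) without logarithms. Its
coefficients are below those of the explicit bound once log n ≥ 1. For small n the trivial regret
2RGn is already at most the summand 4RG√n. -/

theorem expectation_eq_sum {A : Type} (p : PMF A) (X : A → ℝ) (s : Finset A)
    (hs : p.support ⊆ s) : expectation p X = ∑ a ∈ s, (p a).toReal * X a := by
  refine tsum_eq_sum fun a ha => ?_
  have : p a = 0 := by
    by_contra h
    exact ha (hs ((PMF.mem_support_iff p a).2 h))
  simp [this]

theorem sum_toReal_eq_one {A : Type} (p : PMF A) (s : Finset A) (hs : p.support ⊆ s) :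
    ∑ a ∈ s, (p a).toReal = 1 := by
  rw [← ENNReal.toReal_sum fun a _ => p.apply_ne_top a]
  have : ∑ a ∈ s, p a = ∑' a, p a := by
    refine (tsum_eq_sum fun a ha => ?_).symm
    by_contra h
    exact ha (hs ((PMF.mem_support_iff p a).2 h))
  rw [this, p.tsum_coe]
  rfl

theorem expectation_pure {A : Type} (a : A) (X : A → ℝ) : expectation (PMF.pure a) X = X a := by
  rw [expectation_eq_sum _ X {a} (by simp)]
  simp

theorem expectation_bind {A B : Type} {p : PMF A} {k : A → PMF B} (hp : p.support.Finite)
    (hk : ∀ a ∈ p.support, (k a).support.Finite) (X : B → ℝ) :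
    expectation (p.bind k) X = expectation p fun a => expectation (k a) X := by
  classical
  have ht : (⋃ a ∈ p.support, (k a).support).Finite := hp.biUnion hk
  rw [expectation_eq_sum (p.bind k) X ht.toFinset (by simp [PMF.support_bind]),
    expectation_eq_sum p _ hp.toFinset (by simp)]
  have h1 : ∀ a ∈ hp.toFinset,
      (p a).toReal * expectation (k a) X =
        ∑ x ∈ ht.toFinset, (p a).toReal * ((k a x).toReal * X x) := by
    intro a ha
    rw [expectation_eq_sum (k a) X ht.toFinset, Finset.mul_sum]
    intro x hx
    simp only [Set.Finite.coe_toFinset, Set.mem_iUnion]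
    exact ⟨a, by simpa using ha, hx⟩
  rw [Finset.sum_congr rfl h1, Finset.sum_comm]
  refine Finset.sum_congr rfl fun x _ => ?_
  have h2 : (p.bind k x).toReal = ∑ a ∈ hp.toFinset, (p a).toReal * (k a x).toReal := by
    rw [PMF.bind_apply, tsum_eq_sum (s := hp.toFinset)]
    · rw [ENNReal.toReal_sum]
      · simp
      · exact fun a _ => ENNReal.mul_ne_top (p.apply_ne_top a) ((k a).apply_ne_top x)
    · intro a ha
      have : p a = 0 := by
        by_contra h
        exact ha (by simpa using h)
      simp [this]
  rw [h2, Finset.sum_mul]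
  exact Finset.sum_congr rfl fun a _ => by ring

theorem expectation_map {A B : Type} {p : PMF A} (hp : p.support.Finite) (k : A → B)
    (X : B → ℝ) : expectation (p.map k) X = expectation p fun a => X (k a) := by
  rw [← PMF.bind_pure_comp, expectation_bind hp (by simp)]
  simp only [Function.comp, expectation_pure]

theorem expectation_mono {A : Type} {p : PMF A} (hp : p.support.Finite) {X Y : A → ℝ}
    (h : ∀ a ∈ p.support, X a ≤ Y a) : expectation p X ≤ expectation p Y := by
  rw [expectation_eq_sum p X hp.toFinset (by simp), expectation_eq_sum p Y hp.toFinset (by simp)]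
  exact Finset.sum_le_sum fun a ha =>
    mul_le_mul_of_nonneg_left (h a (by simpa using ha)) ENNReal.toReal_nonneg

theorem expectation_const {A : Type} {p : PMF A} (hp : p.support.Finite) (c : ℝ) :
    expectation p (fun _ => c) = c := by
  rw [expectation_eq_sum p _ hp.toFinset (by simp), ← Finset.sum_mul,
    sum_toReal_eq_one p _ (by simp), one_mul]

theorem expectation_add {A : Type} {p : PMF A} (hp : p.support.Finite) (X Y : A → ℝ) :
    expectation p (fun a => X a + Y a) = expectation p X + expectation p Y := by
  simp only [expectation_eq_sum p _ hp.toFinset (Set.Finite.coe_toFinset hp).ge, mul_add,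
    Finset.sum_add_distrib]

theorem expectation_const_mul {A : Type} (p : PMF A) (c : ℝ) (X : A → ℝ) :
    expectation p (fun a => c * X a) = c * expectation p X := by
  unfold expectation
  rw [← tsum_mul_left]
  exact tsum_congr fun a => by ring

theorem expectation_finset_sum {A ι : Type} {p : PMF A} (hp : p.support.Finite) (s : Finset ι)
    (X : ι → A → ℝ) :
    expectation p (fun a => ∑ i ∈ s, X i a) = ∑ i ∈ s, expectation p (X i) := by
  simp only [expectation_eq_sum p _ hp.toFinset (Set.Finite.coe_toFinset hp).ge, Finset.mul_sum]
  exact Finset.sum_comm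

/-- Nonnegativity of the variance. This is the only form of Jensen's inequality used. -/
theorem expectation_sq_le {A : Type} {p : PMF A} (hp : p.support.Finite) (X : A → ℝ) :
    expectation p X ^ 2 ≤ expectation p fun a => X a ^ 2 := by
  set m := expectation p X with hm
  have h : expectation p (fun _ => -m ^ 2) ≤
      expectation p (fun a => X a ^ 2 + (-2 * m) * X a) :=
    expectation_mono hp fun a _ => by nlinarith [sq_nonneg (X a - m)]
  rw [expectation_const hp, expectation_add hp, expectation_const_mul, ← hm] at h
  linarith

theorem expectation_abs_le_sqrt {A : Type} {p : PMF A} (hp : p.support.Finite) {X : A → ℝ}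
    {v : ℝ} (h : expectation p (fun a => X a ^ 2) ≤ v) :
    expectation p (fun a => |X a|) ≤ √v := by
  refine Real.le_sqrt_of_sq_le ((expectation_sq_le hp _).trans ?_)
  simpa only [sq_abs] using h

/-! ### Coins, counters and rounding -/

theorem expectation_coin {p : ℝ} (h0 : 0 ≤ p) (h1 : p ≤ 1) (X : Bool → ℝ) :
    expectation (coin p) X = p * X true + (1 - p) * X false := by
  have h : ENNReal.ofReal p ≤ 1 := by simpa using h1
  unfold expectation coin
  rw [tsum_bool]
  simp only [PMF.ofFintype_apply, cond_true, cond_false, min_eq_left h]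
  rw [ENNReal.toReal_sub_of_le h ENNReal.one_ne_top, ENNReal.toReal_ofReal h0]
  simp only [ENNReal.toReal_one]
  ring

theorem coin_support_finite (p : ℝ) : (coin p).support.Finite := Set.toFinite _

theorem counterIncrement_support_finite (b : ℝ) (C : ℕ) :
    (counterIncrement b C).support.Finite := by
  rw [counterIncrement, PMF.support_map]
  exact (coin_support_finite _).image _

theorem randomRound_support_finite (x ε : ℝ) : (randomRound x ε).support.Finite := by
  rw [randomRound, PMF.support_map]
  exact (coin_support_finite _).image _

theorem counterIncrement_support {b : ℝ} {C C' : ℕ} (h : C' ∈ (counterIncrement b C).support) :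
    C' = C ∨ C' = C + 1 := by
  rw [counterIncrement, PMF.support_map] at h
  obtain ⟨c, -, rfl⟩ := h
  cases c <;> simp

theorem expectation_counterIncrement {b : ℝ} (hb : 1 < b) (C : ℕ) (X : ℕ → ℝ) :
    expectation (counterIncrement b C) X =
      (b ^ C)⁻¹ * X (C + 1) + (1 - (b ^ C)⁻¹) * X C := by
  have h1 : 1 ≤ b ^ C := one_le_pow₀ hb.le
  rw [counterIncrement, expectation_map (coin_support_finite _),
    expectation_coin (by positivity) (inv_le_one_of_one_le₀ h1)]
  simp

theorem sub_mul_floor {x ε : ℝ} (hε : 0 < ε) : x - ε * ⌊x / ε⌋ = ε * Int.fract (x / ε) := by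
  rw [Int.fract, mul_sub, mul_div_cancel₀ _ hε.ne']

/-- Rounding never jumps over a grid point. Applied to the grid points -R and R, this keeps the
iterates feasible. -/
theorem randomRound_support {x ε z : ℝ} (hε : 0 < ε) (h : z ∈ (randomRound x ε).support) :
    |z - x| ≤ ε ∧ ∀ k : ℤ, (k * ε ≤ x → k * ε ≤ z) ∧ (x ≤ k * ε → z ≤ k * ε) := by
  have hx : x = ε * (x / ε) := (mul_div_cancel₀ _ hε.ne').symm
  have hl (k : ℤ) : k * ε ≤ x ↔ (k : ℝ) ≤ x / ε := (le_div_iff₀ hε).symm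
  have hu (k : ℤ) : x ≤ k * ε ↔ x / ε ≤ (k : ℝ) := (div_le_iff₀ hε).symm
  simp only [hl, hu]
  rw [randomRound, PMF.support_map] at h
  obtain ⟨c, -, rfl⟩ := h
  have f1 := Int.floor_le (x / ε)
  have f2 := Int.lt_floor_add_one (x / ε)
  have c1 := Int.le_ceil (x / ε)
  have c2 := Int.ceil_lt_add_one (x / ε)
  cases c
  · simp only [Bool.false_eq_true, if_false]
    refine ⟨abs_le.2 ⟨?_, ?_⟩, fun k => ⟨fun hk => ?_, fun hk => ?_⟩⟩
    · nlinarith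
    · nlinarith
    · have : (k : ℝ) ≤ ⌊x / ε⌋ := by exact_mod_cast Int.le_floor.2 hk
      nlinarith
    · nlinarith
  · simp only [if_true]
    refine ⟨abs_le.2 ⟨?_, ?_⟩, fun k => ⟨fun hk => ?_, fun hk => ?_⟩⟩
    · nlinarith
    · nlinarith
    · nlinarith
    · have : (⌈x / ε⌉ : ℝ) ≤ k := by exact_mod_cast Int.ceil_le.2 hk
      nlinarith

theorem expectation_randomRound_sub {x ε : ℝ} (hε : 0 < ε) :
    expectation (randomRound x ε) (fun z => z - x) = 0 := by
  have hp : (x - ε * ⌊x / ε⌋) / ε = Int.fract (x / ε) := by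
    rw [sub_mul_floor hε, mul_div_cancel_left₀ _ hε.ne']
  rw [randomRound, expectation_map (coin_support_finite _), hp,
    expectation_coin (Int.fract_nonneg _) (Int.fract_lt_one _).le]
  simp only [if_true, Bool.false_eq_true, if_false]
  have hx : x = ε * (x / ε) := (mul_div_cancel₀ _ hε.ne').symm
  -- On the grid, floor and ceiling coincide instead of differing by 1, but then the coin never
  -- shows `true`.
  by_cases h : Int.fract (x / ε) = 0
  · have := sub_mul_floor (x := x) hε
    rw [h] at this ⊢
    linarith
  · have hc : (⌈x / ε⌉ : ℝ) = ⌊x / ε⌋ + 1 := by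
      have := Int.ceil_eq_add_one_sub_fract h
      rw [this, Int.fract]
      ring
    rw [hc, Int.fract]
    set q := x / ε
    rw [hx]
    ring

/-- Rounding is unbiased, so affine upper bounds pass to the expectation. -/
theorem expectation_randomRound_le {x ε : ℝ} (hε : 0 < ε) {F : ℝ → ℝ} {a c : ℝ}
    (hF : ∀ z, |z - x| ≤ ε → F z ≤ a + c * (z - x)) : expectation (randomRound x ε) F ≤ a := by
  have hfin := randomRound_support_finite x ε
  calc expectation (randomRound x ε) F
      ≤ expectation (randomRound x ε) (fun z => a + c * (z - x)) :=
        expectation_mono hfin fun z hz => hF z (randomRound_support hε hz).1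
    _ = a := by
        rw [expectation_add hfin, expectation_const hfin, expectation_const_mul,
          expectation_randomRound_sub hε, mul_zero, add_zero]


/-! ### One round, seen from a single coordinate -/

/-- The law of the new coefficient and the new counter of a coordinate. -/
noncomputable def coordinateLaw (b R α : ℝ) (ε : ℕ → ℝ) (gi x : ℝ) (C : ℕ) : PMF (ℝ × ℕ) :=
  if gi = 0 then PMF.pure (x, C)
  else
    (counterIncrement b C).bind fun C' =>
      (randomRound (project R (x - learningRate b α C' * gi)) (ε C')).map fun z => (z, C')

theorem coordinateStep_map_self {d : ℕ} (b R α : ℝ) (ε : ℕ → ℝ) (gi : ℝ) (s : State d)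
    (i : Fin d) :
    (coordinateStep b R α ε gi s i).map (fun s => (s.point i, s.counter i)) =
      coordinateLaw b R α ε gi (s.point i) (s.counter i) := by
  unfold coordinateStep coordinateLaw
  split_ifs
  · rw [PMF.pure_map]
  · rw [PMF.map_bind]
    congr 1
    funext C
    rw [PMF.map_comp]
    congr 1
    funext z
    simp

theorem coordinateStep_support_ne {d : ℕ} {b R α : ℝ} {ε : ℕ → ℝ} {gi : ℝ} {s s' : State d}
    {i j : Fin d} (hij : i ≠ j) (h : s' ∈ (coordinateStep b R α ε gi s j).support) :
    s'.point i = s.point i ∧ s'.counter i = s.counter i := by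
  unfold coordinateStep at h
  split_ifs at h
  · rw [PMF.support_pure, Set.mem_singleton_iff] at h
    simp [h]
  · simp only [PMF.support_bind, PMF.support_map, Set.mem_iUnion, Set.mem_image] at h
    obtain ⟨C, -, z, -, rfl⟩ := h
    simp [hij]

theorem bind_congr_support {A B : Type} (p : PMF A) {k k' : A → PMF B}
    (h : ∀ a ∈ p.support, k a = k' a) : p.bind k = p.bind k' := by
  ext x
  simp only [PMF.bind_apply]
  refine tsum_congr fun a => ?_
  by_cases ha : p a = 0
  · simp [ha]
  · rw [h a ((PMF.mem_support_iff p a).2 ha)]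

/-- A step touches only its own coordinate, and a list without duplicates visits coordinate i at
most once. So the marginal of a round at i is a single step at i, whatever the order. -/
theorem foldlM_coordinateStep_map {d : ℕ} (b R α : ℝ) (ε : Fin d → ℕ → ℝ) (v : Fin d → ℝ)
    (i : Fin d) : ∀ (l : List (Fin d)) (_ : l.Nodup) (s : State d),
      ((l.foldlM (fun s j => coordinateStep b R α (ε j) (v j) s j) s : PMF (State d))).map
          (fun s => (s.point i, s.counter i)) =
        if i ∈ l then coordinateLaw b R α (ε i) (v i) (s.point i) (s.counter i)
        else PMF.pure (s.point i, s.counter i)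
  | [], _, s => by
      change (PMF.pure s).map _ = _
      rw [PMF.pure_map]
      simp
  | j :: l, hl, s => by
      obtain ⟨hj, hl'⟩ := List.nodup_cons.1 hl
      change ((coordinateStep b R α (ε j) (v j) s j).bind fun s' =>
        (l.foldlM (fun s j => coordinateStep b R α (ε j) (v j) s j) s' : PMF (State d))).map _ = _
      rw [PMF.map_bind]
      simp only [foldlM_coordinateStep_map b R α ε v i l hl']
      by_cases hij : i = j
      · subst hij
        simp only [hj, if_false, List.mem_cons, true_or, if_true]
        rw [← coordinateStep_map_self, ← PMF.bind_pure_comp]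
        rfl
      · rw [bind_congr_support (k' := fun _ =>
          if i ∈ l then coordinateLaw b R α (ε i) (v i) (s.point i) (s.counter i)
          else PMF.pure (s.point i, s.counter i))]
        · simp [PMF.bind_const, hij]
        · intro s' hs'
          obtain ⟨h1, h2⟩ := coordinateStep_support_ne hij hs'
          rw [h1, h2]

theorem round_map {d : ℕ} (b R α : ℝ) (ε : History d → Fin d → ℕ → ℝ)
    (g : History d → Fin d → ℝ) (h : History d) (i : Fin d) :
    (round b R α ε g h).map (fun s => (s.point i, s.counter i)) =
      coordinateLaw b R α (ε h i) (g h i) (h.state.point i) (h.state.counter i) := by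
  rw [round, foldlM_coordinateStep_map b R α (ε h) (g h) i _ (List.nodup_finRange d)]
  simp

theorem round_support_finite {d : ℕ} (b R α : ℝ) (ε : History d → Fin d → ℕ → ℝ)
    (g : History d → Fin d → ℝ) (h : History d) : (round b R α ε g h).support.Finite :=
  foldlM_support_finite _ (fun s i => coordinateStep_support_finite b R α (ε h i) (g h i) s i) _ _

theorem expectation_round {d : ℕ} (b R α : ℝ) (ε : History d → Fin d → ℕ → ℝ)
    (g : History d → Fin d → ℝ) (h : History d) (i : Fin d) (F : ℝ → ℕ → ℝ) :
    expectation (round b R α ε g h) (fun s => F (s.point i) (s.counter i)) =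
      expectation
        (coordinateLaw b R α (ε h i) (g h i) (h.state.point i) (h.state.counter i))
        (fun q => F q.1 q.2) := by
  rw [← round_map, expectation_map (round_support_finite b R α ε g h)]

theorem expectation_round_of_eq_zero {d : ℕ} (b R α : ℝ) (ε : History d → Fin d → ℕ → ℝ)
    {g : History d → Fin d → ℝ} {h : History d} {i : Fin d} (hg : g h i = 0) (F : ℝ → ℕ → ℝ) :
    expectation (round b R α ε g h) (fun s => F (s.point i) (s.counter i)) =
      F (h.state.point i) (h.state.counter i) := by
  rw [expectation_round, coordinateLaw, if_pos hg, expectation_pure]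

/-- Interface for all potential arguments: given the new counter value C, the rounding error is
unbiased, so any term linear in it (with coefficient `c C`) averages out, and only the two outcomes
of the counter remain. -/
theorem expectation_round_le {d : ℕ} {b R γ α : ℝ} (hb : 1 < b)
    {ε : History d → Fin d → ℕ → ℝ} (hε : IsResolutionSchedule b R γ α ε)
    {g : History d → Fin d → ℝ} {h : History d} {i : Fin d} (hC : 1 ≤ h.state.counter i)
    (hg : g h i ≠ 0) {F : ℝ → ℕ → ℝ} (a c : ℕ → ℝ)
    (hF : ∀ C, 1 ≤ C → ∀ z,
      |z - project R (h.state.point i - learningRate b α C * g h i)| ≤ γ * learningRate b α C →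
      F z C ≤ a C + c C * (z - project R (h.state.point i - learningRate b α C * g h i))) :
    expectation (round b R α ε g h) (fun s => F (s.point i) (s.counter i)) ≤
      (b ^ h.state.counter i)⁻¹ * a (h.state.counter i + 1) +
        (1 - (b ^ h.state.counter i)⁻¹) * a (h.state.counter i) := by
  rw [expectation_round, coordinateLaw, if_neg hg,
    expectation_bind (counterIncrement_support_finite _ _) fun C _ => by
      rw [PMF.support_map]; exact (randomRound_support_finite _ _).image _,
    ← expectation_counterIncrement hb]
  refine expectation_mono (counterIncrement_support_finite _ _) fun C hC' => ?_
  have h1 : 1 ≤ C := by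
    rcases counterIncrement_support hC' with rfl | rfl <;> omega
  obtain ⟨e1, e2, -⟩ := hε h i C h1
  rw [expectation_map (randomRound_support_finite _ _)]
  exact expectation_randomRound_le e1 fun z hz => hF C h1 z (hz.trans e2)

theorem project_mem {R : ℝ} (hR : 0 < R) (x : ℝ) : project R x ∈ Set.Icc (-R) R :=
  ⟨le_max_left _ _, max_le (by linarith) (min_le_right _ _)⟩

theorem round_support {d : ℕ} {b R γ α : ℝ} (hR : 0 < R)
    {ε : History d → Fin d → ℕ → ℝ} (hε : IsResolutionSchedule b R γ α ε)
    {g : History d → Fin d → ℝ} {h : History d} {s : State d}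
    (hs : s ∈ (round b R α ε g h).support) (i : Fin d)
    (hC : 1 ≤ h.state.counter i) (hx : h.state.point i ∈ Set.Icc (-R) R) :
    h.state.counter i ≤ s.counter i ∧ s.point i ∈ Set.Icc (-R) R ∧
      (g h i = 0 → s.point i = h.state.point i ∧ s.counter i = h.state.counter i) := by
  have hm : (s.point i, s.counter i) ∈
      ((round b R α ε g h).map (fun s => (s.point i, s.counter i))).support := by
    rw [PMF.support_map]
    exact ⟨s, hs, rfl⟩
  rw [round_map] at hm
  unfold coordinateLaw at hm
  split_ifs at hm with hg
  · rw [PMF.support_pure, Set.mem_singleton_iff, Prod.mk.injEq] at hm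
    rw [hm.1, hm.2]
    exact ⟨le_rfl, hx, fun _ => ⟨rfl, rfl⟩⟩
  · simp only [PMF.support_bind, PMF.support_map, Set.mem_iUnion, Set.mem_image,
      Prod.mk.injEq] at hm
    obtain ⟨C, hC', z, hz, rfl, rfl⟩ := hm
    have h1 : h.state.counter i ≤ s.counter i := by
      rcases counterIncrement_support hC' with h | h <;> omega
    obtain ⟨e1, -, k, hk⟩ := hε h i _ (hC.trans h1)
    obtain ⟨-, hz'⟩ := randomRound_support e1 hz
    obtain ⟨p1, p2⟩ := project_mem hR
      (h.state.point i - learningRate b α (s.counter i) * g h i)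
    refine ⟨h1, ⟨?_, ?_⟩, fun h => absurd h hg⟩
    · have := (hz' (-k)).1 (by push_cast; linarith)
      push_cast at this
      linarith
    · have := (hz' k).2 (by linarith)
      linarith

/-! ### Histories that can occur -/

theorem play_succ_support {d : ℕ} {b R α : ℝ} {ε : History d → Fin d → ℕ → ℝ}
    {g : History d → Fin d → ℝ} {T : ℕ} {h : History d}
    (hh : h ∈ (play b R α ε g (T + 1)).support) :
    ∃ (s : State d) (h' : History d), h = s :: h' ∧ h' ∈ (play b R α ε g T).support ∧
      s ∈ (round b R α ε g h').support := by
  simp only [play, PMF.support_bind, PMF.support_map, Set.mem_iUnion, Set.mem_image] at hh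
  obtain ⟨h', hh', s, hs, rfl⟩ := hh
  exact ⟨s, h', rfl, hh', hs⟩

theorem play_support_state {d : ℕ} {b R γ α : ℝ} (hR : 0 < R)
    {ε : History d → Fin d → ℕ → ℝ} (hε : IsResolutionSchedule b R γ α ε)
    {g : History d → Fin d → ℝ} (i : Fin d) :
    ∀ {T : ℕ} {h : History d}, h ∈ (play b R α ε g T).support →
      1 ≤ h.state.counter i ∧ h.state.point i ∈ Set.Icc (-R) R
  | 0, h, hh => by
      simp only [play, PMF.support_pure, Set.mem_singleton_iff] at hh
      subst hh
      simp [History.state, initialState, hR.le]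
  | T + 1, h, hh => by
      obtain ⟨s, h', rfl, hh', hs⟩ := play_succ_support hh
      obtain ⟨h1, h2⟩ := play_support_state hR hε i hh'
      obtain ⟨r1, r2, -⟩ := round_support hR hε hs i h1 h2
      exact ⟨h1.trans r1, r2⟩

/-- A quantity that does not increase in expectation in any round. -/
theorem expectation_play_le {d : ℕ} {b R α : ℝ} {ε : History d → Fin d → ℕ → ℝ}
    {g : History d → Fin d → ℝ} (Q : History d → ℝ) :
    ∀ {T : ℕ}, (∀ t < T, ∀ h ∈ (play b R α ε g t).support,
        expectation (round b R α ε g h) (fun s => Q (s :: h)) ≤ Q h) →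
      expectation (play b R α ε g T) Q ≤ Q []
  | 0, _ => (expectation_pure [] Q).le
  | T + 1, hQ => by
      rw [play, expectation_bind (play_support_finite b R α ε g T) fun h _ => by
        rw [PMF.support_map]; exact (round_support_finite b R α ε g h).image _]
      refine le_trans (expectation_mono (play_support_finite b R α ε g T) fun h hh => ?_)
        (expectation_play_le Q fun t ht => hQ t (ht.trans T.lt_succ_self))
      rw [expectation_map (round_support_finite b R α ε g h)]
      exact hQ T T.lt_succ_self h hh


/-! ### The scale `√(τ̃ + 1)` of the learning rate -/

/-- The factor `√(τ̃ + 1)` by which the learning rate is reduced. -/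
noncomputable def counterScale (b : ℝ) (C : ℕ) : ℝ := √(estimatedCount b C + 1)

theorem learningRate_eq (b α : ℝ) (C : ℕ) : learningRate b α C = α / counterScale b C := rfl

theorem estimatedCount_add_one {b : ℝ} (hb : 1 < b) (C : ℕ) :
    estimatedCount b C + 1 = (b ^ C - 1) / (b - 1) := by
  have : b - 1 ≠ 0 := by linarith
  rw [estimatedCount]
  field_simp
  ring

theorem one_le_estimatedCount_add_one {b : ℝ} (hb : 1 < b) {C : ℕ} (hC : 1 ≤ C) :
    1 ≤ estimatedCount b C + 1 := by
  rw [estimatedCount_add_one hb, le_div_iff₀ (by linarith)]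
  have := le_self_pow₀ hb.le (by omega : C ≠ 0)
  linarith

theorem counterScale_one {b : ℝ} : counterScale b 1 = 1 := by
  simp [counterScale, estimatedCount]

theorem counterScale_sq {b : ℝ} (hb : 1 < b) {C : ℕ} (hC : 1 ≤ C) :
    counterScale b C ^ 2 = estimatedCount b C + 1 :=
  Real.sq_sqrt (by linarith [one_le_estimatedCount_add_one hb hC])

theorem one_le_counterScale {b : ℝ} (hb : 1 < b) {C : ℕ} (hC : 1 ≤ C) :
    1 ≤ counterScale b C :=
  Real.one_le_sqrt.2 (one_le_estimatedCount_add_one hb hC)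

theorem counterScale_mono {b : ℝ} (hb : 1 < b) {C C' : ℕ} (h : C ≤ C') :
    counterScale b C ≤ counterScale b C' := by
  refine Real.sqrt_le_sqrt ?_
  rw [estimatedCount_add_one hb, estimatedCount_add_one hb]
  have := pow_le_pow_right₀ hb.le h
  have : 0 < b - 1 := by linarith
  gcongr

theorem counterScale_succ_sq {b : ℝ} (hb : 1 < b) {C : ℕ} (hC : 1 ≤ C) :
    counterScale b (C + 1) ^ 2 = counterScale b C ^ 2 + b ^ C := by
  have : b - 1 ≠ 0 := by linarith
  rw [counterScale_sq hb hC, counterScale_sq hb (by omega), estimatedCount_add_one hb,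
    estimatedCount_add_one hb]
  field_simp
  ring

/-- The square grows by b ^ C, which is at most b (b ^ C - 1) / (b - 1), that is, b times the old
square, because b ≤ b ^ C. -/
theorem counterScale_succ_le {b : ℝ} (hb : 1 < b) {C : ℕ} (hC : 1 ≤ C) :
    counterScale b (C + 1) ≤ √(b + 1) * counterScale b C := by
  have hu := one_le_counterScale hb hC
  refine abs_le_of_sq_le_sq' ?_ (by positivity) |>.2
  rw [counterScale_succ_sq hb hC, mul_pow, Real.sq_sqrt (by linarith), counterScale_sq hb hC,
    estimatedCount_add_one hb]
  have h1 : b ^ C ≤ b * ((b ^ C - 1) / (b - 1)) := by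
    rw [← mul_div_assoc, le_div_iff₀ (by linarith)]
    have := le_self_pow₀ hb.le (by omega : C ≠ 0)
    linarith
  linarith

theorem learningRate_pos {b α : ℝ} (hb : 1 < b) (hα : 0 < α) {C : ℕ} (hC : 1 ≤ C) :
    0 < learningRate b α C := by
  have := one_le_counterScale hb hC
  rw [learningRate_eq]
  positivity

/-- In expectation, one increment raises the scale by at least a constant times the
reciprocal of its new value. -/
theorem counterScale_drift {b : ℝ} (hb : 1 < b) {C : ℕ} (hC : 1 ≤ C) :
    (b ^ C)⁻¹ * (1 / counterScale b (C + 1) - (1 + √(b + 1)) * counterScale b (C + 1)) +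
      (1 - (b ^ C)⁻¹) * (1 / counterScale b C - (1 + √(b + 1)) * counterScale b C) ≤
    -((1 + √(b + 1)) * counterScale b C) := by
  have hB : 0 < b ^ C := by positivity
  have hu := one_le_counterScale hb hC
  have hle := counterScale_mono hb (Nat.le_succ C)
  have hsq := counterScale_succ_sq hb hC
  have hK := counterScale_succ_le hb hC
  set u := counterScale b C
  set u' := counterScale b (C + 1)
  set K := 1 + √(b + 1)
  have hu0 : 0 < u := by linarith
  have hu'0 : 0 < u' := by linarith
  have h1 : 1 / u' ≤ 1 / u := one_div_le_one_div_of_le hu0 hle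
  -- As b ^ C = u'² - u², the mean increase (u' - u) / b ^ C equals 1 / (u' + u), and u' + u ≤ K u.
  have h2 : 1 / u ≤ (b ^ C)⁻¹ * (K * (u' - u)) := by
    have e : b ^ C = (u' - u) * (u' + u) := by linear_combination -hsq
    have hd : 0 < u' - u := by
      by_contra h
      have : (u' - u) * (u' + u) ≤ 0 := mul_nonpos_of_nonpos_of_nonneg (by linarith) (by linarith)
      linarith
    rw [e, show ((u' - u) * (u' + u))⁻¹ * (K * (u' - u)) = K / (u' + u) by
      field_simp, div_le_div_iff₀ hu0 (by linarith)]
    have : K * u = u + √(b + 1) * u := by ring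
    linarith
  have h3 : (b ^ C)⁻¹ * (1 / u') ≤ (b ^ C)⁻¹ * (1 / u) :=
    mul_le_mul_of_nonneg_left h1 (by positivity)
  linear_combination h2 + h3

/-! ### Quantities attached to a history and a coordinate -/

/-- The rounding error of the last round, divided by the learning rate, summed over the rounds
with nonzero gradient. -/
noncomputable def noiseSum {d : ℕ} (b R α : ℝ) (g : History d → Fin d → ℝ) (i : Fin d) :
    History d → ℝ
  | [] => 0
  | s :: h =>
    (if g h i = 0 then 0
      else (s.point i - project R (History.point h i - learningRate b α (s.counter i) * g h i)) /
        learningRate b α (s.counter i)) + noiseSum b R α g i h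

/-- The second order cost of a step with learning rate `η` and gradient `v`, where `y` is rounded
to `z`. -/
noncomputable def stepCost (η v y z : ℝ) : ℝ :=
  (η * v ^ 2 + (z - y) ^ 2 / η) / 2 + (z - y) * y / η

/-- The sum of the second order costs over the rounds with nonzero gradient. -/
noncomputable def costSum {d : ℕ} (b R α : ℝ) (g : History d → Fin d → ℝ) (i : Fin d) :
    History d → ℝ
  | [] => 0
  | s :: h =>
    (if g h i = 0 then 0
      else stepCost (learningRate b α (s.counter i)) (g h i)
        (project R (History.point h i - learningRate b α (s.counter i) * g h i)) (s.point i)) +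
      costSum b R α g i h

/-- The regret of coordinate `i` with respect to the linearized losses and the point `β`. -/
def linearRegret {d : ℕ} (g : History d → Fin d → ℝ) (i : Fin d) (β : ℝ) : History d → ℝ
  | [] => 0
  | _ :: h => g h i * (History.point h i - β) + linearRegret g i β h

/-- The gradient bound along all histories that can occur. -/
def GradientBound {d : ℕ} (b R G α : ℝ) (ε : History d → Fin d → ℕ → ℝ)
    (g : History d → Fin d → ℝ) (T : ℕ) : Prop :=
  ∀ t < T, ∀ h ∈ (play b R α ε g t).support, ∀ i, |g h i| ≤ G

theorem abs_project_sub_le {R β : ℝ} (hβ : β ∈ Set.Icc (-R) R) (x : ℝ) :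
    |project R x - β| ≤ |x - β| := by
  obtain ⟨h1, h2⟩ := hβ
  unfold project
  rcases le_total x R with h | h
  · rw [min_eq_left h]
    rcases le_total (-R) x with h' | h'
    · rw [max_eq_right h']
    · rw [max_eq_left h', abs_of_nonpos (by linarith), abs_of_nonpos (by linarith)]
      linarith
  · rw [min_eq_right h, max_eq_right (by linarith), abs_of_nonneg (by linarith),
      abs_of_nonneg (by linarith)]
    linarith

/-- The basic inequality of gradient descent for one rounded step. -/
theorem gradient_step_le {R η v x z β : ℝ} (hη : 0 < η) (hβ : β ∈ Set.Icc (-R) R) :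
    v * (x - β) + (z - β) ^ 2 / (2 * η) ≤
      (x - β) ^ 2 / (2 * η) + stepCost η v (project R (x - η * v)) z -
        β * ((z - project R (x - η * v)) / η) := by
  have h := sq_le_sq.2 (abs_project_sub_le hβ (x - η * v))
  set y := project R (x - η * v)
  have e : (x - β) ^ 2 / (2 * η) + stepCost η v y z - β * ((z - y) / η) -
      (v * (x - β) + (z - β) ^ 2 / (2 * η)) =
      ((x - η * v - β) ^ 2 - (y - β) ^ 2) / (2 * η) := by
    unfold stepCost
    field_simp
    ring
  have : 0 ≤ ((x - η * v - β) ^ 2 - (y - β) ^ 2) / (2 * η) :=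
    div_nonneg (by linarith) (by linarith)
  linarith

section

variable {d : ℕ} {b R G γ α : ℝ} {ε : History d → Fin d → ℕ → ℝ} {g : History d → Fin d → ℝ}

/-- Keeping (x - β)²/(2η) on the left makes the induction close: lowering the learning rate from η₀
to η raises this term by at most 2R² (1/η - 1/η₀), since |x - β| ≤ 2R, and these increments
telescope to 2R²/η. -/
theorem linearRegret_add_le (hb : 1 < b) (hR : 0 < R) (hα : 0 < α)
    (hε : IsResolutionSchedule b R γ α ε) (i : Fin d) {β : ℝ} (hβ : β ∈ Set.Icc (-R) R) :
    ∀ {T : ℕ} {h : History d}, h ∈ (play b R α ε g T).support →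
      linearRegret g i β h +
          (h.point i - β) ^ 2 / (2 * learningRate b α (h.state.counter i)) ≤
        2 * R ^ 2 / learningRate b α (h.state.counter i) + costSum b R α g i h -
          β * noiseSum b R α g i h
  | 0, h, hh => by
      simp only [play, PMF.support_pure, Set.mem_singleton_iff] at hh
      subst hh
      have : β ^ 2 ≤ R ^ 2 := sq_le_sq' hβ.1 hβ.2
      simp only [linearRegret, History.point, History.state, initialState, List.headD_nil,
        costSum, noiseSum, learningRate_eq, counterScale_one, div_one, zero_sub, mul_zero,
        sub_zero, add_zero, zero_add, even_two, Even.neg_pow]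
      rw [div_le_div_iff₀ (by positivity) hα]
      nlinarith [sq_nonneg R]
  | T + 1, h, hh => by
      obtain ⟨s, h', rfl, hh', hs⟩ := play_succ_support hh
      obtain ⟨hC, hx⟩ := play_support_state hR hε i hh'
      obtain ⟨hCC, hz, h0⟩ := round_support hR hε hs i hC hx
      have ih := linearRegret_add_le hb hR hα hε i hβ hh'
      have hη' := learningRate_pos hb hα (hC.trans hCC)
      have hη := learningRate_pos hb hα hC
      change _ + (s.point i - β) ^ 2 / (2 * learningRate b α (s.counter i)) ≤
        2 * R ^ 2 / learningRate b α (s.counter i) + _ - _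
      simp only [linearRegret, costSum, noiseSum]
      by_cases hg : g h' i = 0
      · obtain ⟨e1, e2⟩ := h0 hg
        simp only [hg, if_true, e1, e2, zero_mul, zero_add]
        exact ih
      · simp only [if_neg hg]
        have hmono : learningRate b α (s.counter i) ≤
            learningRate b α ((History.state h').counter i) := by
          rw [learningRate_eq, learningRate_eq]
          have h1 := one_le_counterScale hb hC
          exact div_le_div_of_nonneg_left hα.le (by linarith) (counterScale_mono hb hCC)
        have key := gradient_step_le (v := g h' i) (x := History.point h' i) (z := s.point i) hη' hβ
        set η := learningRate b α (s.counter i)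
        set η₀ := learningRate b α ((History.state h').counter i)
        have hinv : 0 ≤ 1 / η - 1 / η₀ := sub_nonneg.2 (one_div_le_one_div_of_le hη' hmono)
        have hD : (History.point h' i - β) ^ 2 ≤ 4 * R ^ 2 := by
          have h3 : |History.point h' i - β| ≤ 2 * R := by
            rw [abs_le]
            constructor <;> [linarith [hx.1, hβ.2, show History.point h' i = (History.state h').point i from rfl];
              linarith [hx.2, hβ.1, show History.point h' i = (History.state h').point i from rfl]]
          calc (History.point h' i - β) ^ 2 = |History.point h' i - β| ^ 2 := (sq_abs _).symm
            _ ≤ (2 * R) ^ 2 := pow_le_pow_left₀ (abs_nonneg _) h3 2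
            _ = 4 * R ^ 2 := by ring
        have hmul := mul_le_mul_of_nonneg_right hD hinv
        have e1 : (History.point h' i - β) ^ 2 * (1 / η - 1 / η₀) =
            2 * ((History.point h' i - β) ^ 2 / (2 * η) - (History.point h' i - β) ^ 2 / (2 * η₀)) := by
          field_simp
        have e2 : 4 * R ^ 2 * (1 / η - 1 / η₀) = 2 * (2 * R ^ 2 / η - 2 * R ^ 2 / η₀) := by
          field_simp
          ring
        rw [e1, e2] at hmul
        linarith

theorem linearRegret_le (hb : 1 < b) (hR : 0 < R) (hα : 0 < α)
    (hε : IsResolutionSchedule b R γ α ε) (i : Fin d) {β : ℝ} (hβ : β ∈ Set.Icc (-R) R)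
    {T : ℕ} {h : History d} (hh : h ∈ (play b R α ε g T).support) :
    linearRegret g i β h ≤ 2 * R ^ 2 / α * counterScale b (h.state.counter i) +
      costSum b R α g i h + R * |noiseSum b R α g i h| := by
  have key := linearRegret_add_le hb hR hα hε i hβ hh
  have hη := learningRate_pos hb hα (play_support_state hR hε i hh).1
  have h1 : 0 ≤ (h.point i - β) ^ 2 / (2 * learningRate b α (h.state.counter i)) := by positivity
  have h2 : -(β * noiseSum b R α g i h) ≤ R * |noiseSum b R α g i h| := by
    refine (neg_le_abs _).trans ?_
    rw [abs_mul]
    exact mul_le_mul_of_nonneg_right (abs_le.2 hβ) (abs_nonneg _)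
  have h3 : 2 * R ^ 2 / learningRate b α (h.state.counter i) =
      2 * R ^ 2 / α * counterScale b (h.state.counter i) := by
    rw [learningRate_eq, div_div_eq_mul_div]
    ring
  linarith

theorem linearRegret_le_nonzeroCount (hR : 0 < R) (hε : IsResolutionSchedule b R γ α ε)
    (i : Fin d) {β : ℝ} (hβ : β ∈ Set.Icc (-R) R) :
    ∀ {T : ℕ} {h : History d}, GradientBound b R G α ε g T →
      h ∈ (play b R α ε g T).support →
      linearRegret g i β h ≤ 2 * R * G * nonzeroCount g i h
  | 0, h, _, hh => by
      simp only [play, PMF.support_pure, Set.mem_singleton_iff] at hh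
      subst hh
      simp [linearRegret, nonzeroCount]
  | T + 1, h, hG, hh => by
      obtain ⟨s, h', rfl, hh', hs⟩ := play_succ_support hh
      obtain ⟨hC, hx⟩ := play_support_state hR hε i hh'
      have ih := linearRegret_le_nonzeroCount hR hε i hβ
        (fun t ht => hG t (ht.trans T.lt_succ_self)) hh'
      simp only [linearRegret, nonzeroCount]
      by_cases hg : g h' i = 0
      · simpa [hg] using ih
      · have hgG := hG T T.lt_succ_self h' hh' i
        have h3 : |History.point h' i - β| ≤ 2 * R := by
          have hp : History.point h' i = (History.state h').point i := rfl
          rw [abs_le, hp]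
          constructor <;> linarith [hx.1, hx.2, hβ.1, hβ.2]
        have h4 : g h' i * (History.point h' i - β) ≤ G * (2 * R) := by
          refine (le_abs_self _).trans ?_
          rw [abs_mul]
          exact mul_le_mul hgG h3 (abs_nonneg _) ((abs_nonneg _).trans hgG)
        simp only [if_neg hg]
        push_cast
        linarith

/-! ### Potentials -/

/-- The counter is unbiased: with probability b ^ (-C) the square of the scale grows by b ^ C, so by
1 on average. The right-hand side is the initial value. -/
theorem expectation_counterScale_sq (hb : 1 < b) (hR : 0 < R)
    (hε : IsResolutionSchedule b R γ α ε) (i : Fin d) (T : ℕ) :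
    expectation (play b R α ε g T)
      (fun h => counterScale b (h.state.counter i) ^ 2 + -1 * (nonzeroCount g i h : ℝ)) ≤ 1 := by
  refine (expectation_play_le _ fun t _ h hh => ?_).trans_eq
    (by simp [History.state, initialState, counterScale_one, nonzeroCount])
  obtain ⟨hC, -⟩ := play_support_state hR hε i hh
  by_cases hg : g h i = 0
  · simp only [nonzeroCount, hg, if_true, zero_add]
    exact (expectation_round_of_eq_zero b R α ε hg
      (fun _ C => counterScale b C ^ 2 + -1 * (nonzeroCount g i h : ℝ))).le
  · simp only [nonzeroCount, hg, if_false]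
    refine (expectation_round_le hb hε hC hg
      (F := fun _ C => counterScale b C ^ 2 + -1 * ((1 + nonzeroCount g i h : ℕ) : ℝ))
      (fun C => counterScale b C ^ 2 + -1 * ((1 + nonzeroCount g i h : ℕ) : ℝ)) (fun _ => 0)
      (fun C _ z _ => by simp)).trans_eq ?_
    rw [counterScale_succ_sq hb hC]
    have : b ^ h.state.counter i ≠ 0 := by positivity
    push_cast
    field_simp
    ring

/-- Normalized rounding errors are at most γ in absolute value and orthogonal to the past, so second
moments add up. -/
theorem expectation_noiseSum_sq (hb : 1 < b) (hR : 0 < R) (hα : 0 < α)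
    (hε : IsResolutionSchedule b R γ α ε) (i : Fin d) (T : ℕ) :
    expectation (play b R α ε g T)
      (fun h => noiseSum b R α g i h ^ 2 + -γ ^ 2 * (nonzeroCount g i h : ℝ)) ≤ 0 := by
  refine (expectation_play_le _ fun t _ h hh => ?_).trans_eq
    (by simp [noiseSum, nonzeroCount])
  obtain ⟨hC, -⟩ := play_support_state hR hε i hh
  by_cases hg : g h i = 0
  · simp only [nonzeroCount, noiseSum, hg, if_true, zero_add]
    exact (expectation_const (round_support_finite b R α ε g h) _).le
  · simp only [nonzeroCount, noiseSum, hg, if_false]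
    set M := noiseSum b R α g i h
    refine (expectation_round_le hb hε hC hg
      (F := fun z C => ((z - project R (h.state.point i - learningRate b α C * g h i)) /
        learningRate b α C + M) ^ 2 + -γ ^ 2 * ((1 + nonzeroCount g i h : ℕ) : ℝ))
      (fun _ => M ^ 2 + -γ ^ 2 * (nonzeroCount g i h : ℝ))
      -- The cross term of the square; its coefficient is fixed before rounding, as M depends only
      -- on the past.
      (fun C => 2 * M / learningRate b α C) (fun C hC z hz => ?_)).trans ?_
    rotate_left
    · exact le_of_eq (by ring)
    have hη := learningRate_pos hb hα hC
    set η := learningRate b α C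
    set ξ := z - project R (h.state.point i - η * g h i)
    have h1 : (ξ / η) ^ 2 ≤ γ ^ 2 := by
      rw [← sq_abs, abs_div, abs_of_pos hη]
      exact pow_le_pow_left₀ (by positivity) ((div_le_iff₀ hη).2 hz) 2
    have e : 2 * M / η * ξ = 2 * M * (ξ / η) := by ring
    rw [e]
    push_cast
    linear_combination h1

/-- Up to a mean-zero term, a step costs at most (G² + γ²) η / 2, and `counterScale_drift` pays for
this by the expected growth of the scale. -/
theorem expectation_costSum (hb : 1 < b) (hR : 0 < R) (hα : 0 < α)
    (hε : IsResolutionSchedule b R γ α ε) (i : Fin d) {T : ℕ}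
    (hG : GradientBound b R G α ε g T) :
    expectation (play b R α ε g T)
      (fun h => costSum b R α g i h +
        -(α * (G ^ 2 + γ ^ 2) / 2 * (1 + √(b + 1))) * counterScale b (h.state.counter i)) ≤
      -(α * (G ^ 2 + γ ^ 2) / 2 * (1 + √(b + 1))) := by
  refine (expectation_play_le _ fun t ht h hh => ?_).trans_eq
    (by simp [History.state, initialState, counterScale_one, costSum])
  obtain ⟨hC, -⟩ := play_support_state hR hε i hh
  set κ := α * (G ^ 2 + γ ^ 2) / 2 * (1 + √(b + 1)) with hκ
  by_cases hg : g h i = 0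
  · simp only [costSum, hg, if_true, zero_add]
    exact (expectation_round_of_eq_zero b R α ε hg
      (fun _ C => costSum b R α g i h + -κ * counterScale b C)).le
  · simp only [costSum, hg, if_false]
    set A := costSum b R α g i h
    refine (expectation_round_le hb hε hC hg
      (F := fun z C => stepCost (learningRate b α C) (g h i)
        (project R (h.state.point i - learningRate b α C * g h i)) z + A +
          -κ * counterScale b C)
      (fun C => A + α * (G ^ 2 + γ ^ 2) / 2 *
        (1 / counterScale b C - (1 + √(b + 1)) * counterScale b C))
      (fun C => project R (h.state.point i - learningRate b α C * g h i) / learningRate b α C)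
      (fun C hC z hz => ?_)).trans ?_
    · have hη := learningRate_pos hb hα hC
      have e0 : α * (1 / counterScale b C) = learningRate b α C := by
        rw [learningRate_eq]; ring
      set η := learningRate b α C
      set y := project R (h.state.point i - η * g h i)
      have h1 : (z - y) ^ 2 / η ≤ γ ^ 2 * η := by
        rw [div_le_iff₀ hη, ← sq_abs]
        calc |z - y| ^ 2 ≤ (γ * η) ^ 2 := pow_le_pow_left₀ (abs_nonneg _) hz 2
          _ = γ ^ 2 * η * η := by ring
      have h2 : η * g h i ^ 2 ≤ η * G ^ 2 := by
        refine mul_le_mul_of_nonneg_left ?_ hη.le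
        rw [← sq_abs]
        exact pow_le_pow_left₀ (abs_nonneg _) (hG t ht h hh i) 2
      have e1 : α * (G ^ 2 + γ ^ 2) / 2 *
          (1 / counterScale b C - (1 + √(b + 1)) * counterScale b C) =
          (G ^ 2 + γ ^ 2) / 2 * η - κ * counterScale b C := by
        rw [← e0, hκ]; ring
      have e2 : y / η * (z - y) = (z - y) * y / η := by ring
      rw [e1, e2]
      unfold stepCost
      linarith
    · have hd := mul_le_mul_of_nonneg_left (counterScale_drift hb hC)
        (by positivity : 0 ≤ α * (G ^ 2 + γ ^ 2) / 2)
      rw [hκ]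
      linear_combination hd

/-! ### Bounds for one coordinate -/

theorem expectation_nonzeroCount_le {T n : ℕ} {i : Fin d}
    (hn : ∀ h ∈ (play b R α ε g T).support, nonzeroCount g i h ≤ n) :
    expectation (play b R α ε g T) (fun h => (nonzeroCount g i h : ℝ)) ≤ n := by
  have hfin := play_support_finite b R α ε g T
  rw [← expectation_const hfin (n : ℝ)]
  exact expectation_mono hfin fun h hh => by exact_mod_cast hn h hh

theorem expectation_counterScale_le (hb : 1 < b) (hR : 0 < R)
    (hε : IsResolutionSchedule b R γ α ε) {i : Fin d} {T n : ℕ}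
    (hn : ∀ h ∈ (play b R α ε g T).support, nonzeroCount g i h ≤ n) :
    expectation (play b R α ε g T) (fun h => counterScale b (h.state.counter i)) ≤
      √(n + 1) := by
  have hfin := play_support_finite b R α ε g T
  have h1 := expectation_counterScale_sq (g := g) hb hR hε i T
  rw [expectation_add hfin, expectation_const_mul] at h1
  have h2 := expectation_nonzeroCount_le hn
  exact Real.le_sqrt_of_sq_le ((expectation_sq_le hfin _).trans (by linarith))

theorem expectation_noiseSum_le (hb : 1 < b) (hR : 0 < R) (hα : 0 < α) (hγ : 0 < γ)
    (hε : IsResolutionSchedule b R γ α ε) {i : Fin d} {T n : ℕ}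
    (hn : ∀ h ∈ (play b R α ε g T).support, nonzeroCount g i h ≤ n) :
    expectation (play b R α ε g T) (fun h => |noiseSum b R α g i h|) ≤ γ * √n := by
  have hfin := play_support_finite b R α ε g T
  have h1 := expectation_noiseSum_sq (g := g) hb hR hα hε i T
  rw [expectation_add hfin, expectation_const_mul] at h1
  have h2 := mul_le_mul_of_nonneg_left (expectation_nonzeroCount_le hn) (sq_nonneg γ)
  have h3 := expectation_abs_le_sqrt (v := γ ^ 2 * n) hfin
    (X := noiseSum b R α g i) (by linarith)
  rwa [Real.sqrt_mul (sq_nonneg γ), Real.sqrt_sq hγ.le] at h3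

theorem expectation_regret_bound_le (hb : 1 < b) (hR : 0 < R) (hα : 0 < α) (hγ : 0 < γ)
    (hε : IsResolutionSchedule b R γ α ε) {i : Fin d} {T n : ℕ}
    (hG : GradientBound b R G α ε g T)
    (hn : ∀ h ∈ (play b R α ε g T).support, nonzeroCount g i h ≤ n) :
    expectation (play b R α ε g T) (fun h =>
        2 * R ^ 2 / α * counterScale b (h.state.counter i) +
          costSum b R α g i h + R * |noiseSum b R α g i h|) ≤
      2 * R ^ 2 * √(n + 1) / α + (G ^ 2 + γ ^ 2) * (α * √n * ((1 + √(b + 1)) / 2)) +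
        γ * R * √n := by
  have hfin := play_support_finite b R α ε g T
  rw [expectation_add hfin, expectation_add hfin, expectation_const_mul, expectation_const_mul]
  have h1 := expectation_counterScale_le hb hR hε hn
  have h2 := expectation_noiseSum_le hb hR hα hγ hε hn
  have h3 := expectation_costSum hb hR hα hε i hG
  rw [expectation_add hfin, expectation_const_mul] at h3
  -- The initial scale 1 is subtracted in the bound on the costs, so √(n + 1) can be replaced by √n
  -- there.
  have h4 : √((n : ℝ) + 1) ≤ √n + 1 := by
    rw [Real.sqrt_le_left (by positivity)]
    nlinarith [Real.sq_sqrt (Nat.cast_nonneg (α := ℝ) n), Real.sqrt_nonneg (n : ℝ)]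
  have h5 := mul_le_mul_of_nonneg_left (h1.trans h4)
    (by positivity : 0 ≤ α * (G ^ 2 + γ ^ 2) / 2 * (1 + √(b + 1)))
  have h6 := mul_le_mul_of_nonneg_left h1 (by positivity : 0 ≤ 2 * R ^ 2 / α)
  have h7 := mul_le_mul_of_nonneg_left h2 hR.le
  linear_combination h3 + h5 + h6 + h7

end


/-! ### From losses to coordinates -/

section

variable {d : ℕ} {b R G γ α : ℝ} {ε : History d → Fin d → ℕ → ℝ} {g : History d → Fin d → ℝ}
  {f : History d → (Fin d → ℝ) → ℝ}

theorem IsAdversary.gradientBound {T : ℕ} (hA : IsAdversary b R G α ε f g T) :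
    GradientBound b R G α ε g T :=
  fun t ht h hh i => (hA t ht h hh).2.2 i

theorem playedLoss_sub_fixedLoss_le {x : Fin d → ℝ} (hx : x ∈ feasible d R) :
    ∀ {T : ℕ} {h : History d}, IsAdversary b R G α ε f g T →
      h ∈ (play b R α ε g T).support →
      playedLoss f h - fixedLoss f x h ≤ ∑ i, linearRegret g i (x i) h
  | 0, h, _, hh => by
      simp only [play, PMF.support_pure, Set.mem_singleton_iff] at hh
      subst hh
      simp [playedLoss, fixedLoss, linearRegret]
  | T + 1, h, hA, hh => by
      obtain ⟨s, h', rfl, hh', -⟩ := play_succ_support hh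
      have ih := playedLoss_sub_fixedLoss_le hx (fun t ht => hA t (ht.trans T.lt_succ_self)) hh'
      have h1 := (hA T T.lt_succ_self h' hh').2.1 x hx
      have h2 : ∑ i, g h' i * (x i - History.point h' i) =
          -∑ i, g h' i * (History.point h' i - x i) := by
        rw [← Finset.sum_neg_distrib]
        exact Finset.sum_congr rfl fun i _ => by ring
      simp only [playedLoss, fixedLoss, linearRegret, Finset.sum_add_distrib]
      linarith

theorem regret_le (hR : 0 < R) {h : History d} {B : ℝ}
    (hB : ∀ x ∈ feasible d R, playedLoss f h - fixedLoss f x h ≤ B) : regret R f h ≤ B := by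
  have : playedLoss f h - B ≤ sInf ((fun x => fixedLoss f x h) '' feasible d R) := by
    refine le_csInf (Set.Nonempty.image _ ⟨0, fun i => ⟨by simpa using hR.le, hR.le⟩⟩) ?_
    rintro _ ⟨x, hx, rfl⟩
    linarith [hB x hx]
  unfold regret
  linarith

/-- Bounds for the linearized regret of the coordinates add up to a bound for the regret. -/
theorem expectation_regret_le_sum (hR : 0 < R) {T : ℕ} (hA : IsAdversary b R G α ε f g T)
    {B : Fin d → ℝ}
    (hB : ∀ i, ∃ X : History d → ℝ, (∀ h ∈ (play b R α ε g T).support,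
      ∀ β ∈ Set.Icc (-R) R, linearRegret g i β h ≤ X h) ∧
      expectation (play b R α ε g T) X ≤ B i) :
    expectation (play b R α ε g T) (regret R f) ≤ ∑ i, B i := by
  choose X hX hXB using hB
  have hfin := play_support_finite b R α ε g T
  calc expectation (play b R α ε g T) (regret R f)
      ≤ expectation (play b R α ε g T) (fun h => ∑ i, X i h) :=
        expectation_mono hfin fun h hh => regret_le hR fun x hx =>
          (playedLoss_sub_fixedLoss_le hx hA hh).trans
            (Finset.sum_le_sum fun i _ => hX i h hh _ (hx i))
    _ = ∑ i, expectation (play b R α ε g T) (X i) := expectation_finset_sum hfin _ _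
    _ ≤ ∑ i, B i := Finset.sum_le_sum fun i _ => hXB i

theorem nonzeroCount_le (i : Fin d) :
    ∀ {T : ℕ} {h : History d}, h ∈ (play b R α ε g T).support → nonzeroCount g i h ≤ T
  | 0, h, hh => by
      simp only [play, PMF.support_pure, Set.mem_singleton_iff] at hh
      subst hh
      simp [nonzeroCount]
  | T + 1, h, hh => by
      obtain ⟨s, h', rfl, hh', -⟩ := play_succ_support hh
      have ih := nonzeroCount_le i hh'
      simp only [nonzeroCount]
      split_ifs <;> omega

theorem exists_linearRegret_bound (hb : 1 < b) (hR : 0 < R) (hα : 0 < α) (hγ : 0 < γ)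
    (hε : IsResolutionSchedule b R γ α ε) {T n : ℕ} (i : Fin d)
    (hG : GradientBound b R G α ε g T)
    (hn : ∀ h ∈ (play b R α ε g T).support, nonzeroCount g i h ≤ n) :
    ∃ X : History d → ℝ, (∀ h ∈ (play b R α ε g T).support,
      ∀ β ∈ Set.Icc (-R) R, linearRegret g i β h ≤ X h) ∧
      expectation (play b R α ε g T) X ≤
        2 * R ^ 2 * √(n + 1) / α + (G ^ 2 + γ ^ 2) * (α * √n * ((1 + √(b + 1)) / 2)) +
          γ * R * √n :=
  ⟨_, fun _ hh _ hβ => linearRegret_le hb hR hα hε i hβ hh,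
    expectation_regret_bound_le hb hR hα hγ hε hG hn⟩

theorem exists_linearRegret_bound_trivial (hR : 0 < R) (hG0 : 0 ≤ G)
    (hε : IsResolutionSchedule b R γ α ε) {T n : ℕ} (i : Fin d)
    (hG : GradientBound b R G α ε g T)
    (hn : ∀ h ∈ (play b R α ε g T).support, nonzeroCount g i h ≤ n) :
    ∃ X : History d → ℝ, (∀ h ∈ (play b R α ε g T).support,
      ∀ β ∈ Set.Icc (-R) R, linearRegret g i β h ≤ X h) ∧
      expectation (play b R α ε g T) X ≤ 2 * R * G * n := by
  refine ⟨_, fun _ hh _ hβ => linearRegret_le_nonzeroCount hR hε i hβ hG hh, ?_⟩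
  rw [expectation_const_mul]
  exact mul_le_mul_of_nonneg_left (expectation_nonzeroCount_le hn) (by positivity)

end

/-! ### Comparison with the explicit bound -/

theorem one_le_kTwo {b : ℝ} (hb : 1 < b) (n : ℕ) : 1 ≤ kTwo b n := by
  unfold kTwo
  rw [le_div_iff₀ (by linarith), one_mul]
  have h1 : b ≤ b ^ (√(2 * (5 / 2) * Real.logb b n) + 2) :=
    Real.self_le_rpow_of_one_le hb.le (by linarith [Real.sqrt_nonneg (2 * (5 / 2) * Real.logb b n)])
  have h2 : 1 ≤ Real.exp 1 := Real.one_le_exp zero_le_one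
  nlinarith

theorem le_coordinateBound_of_le_four {b R G γ α : ℝ} (hR : 0 < R) (hG : 0 ≤ G)
    (hγ : 0 < γ) (hα : 0 < α) {n : ℕ} (hn : n ≤ 4) :
    2 * R * G * n ≤ coordinateBound b R G γ α n := by
  -- For n ≤ 4 this gives n ≤ 2√n, so 2RGn is covered by the last summand 4RG√n alone.
  have h2 : √(n : ℝ) ≤ 2 := by
    rw [Real.sqrt_le_left (by norm_num)]
    norm_num
    exact_mod_cast hn
  have h3 : (n : ℝ) ≤ 2 * √n := by
    calc (n : ℝ) = √n * √n := (Real.mul_self_sqrt (Nat.cast_nonneg n)).symm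
      _ ≤ 2 * √n := mul_le_mul_of_nonneg_right h2 (Real.sqrt_nonneg _)
  have h4 := mul_le_mul_of_nonneg_left h3 (by positivity : 0 ≤ 2 * R * G)
  have h5 : 0 ≤ 2 * R ^ 2 * √(kTwo b n * n + 1) / α + (G ^ 2 + γ ^ 2) * (α * √n / √(kOne b n))
      + γ * R * √n := by positivity
  unfold coordinateBound
  linarith

theorem le_one_div_sqrt_kOne {b : ℝ} (hb : 1 < b) {n : ℕ} (hn : 3 ≤ n) :
    (1 + √(b + 1)) / 2 ≤ 1 / √(kOne b n) := by
  have hlog : 1 ≤ Real.log n := by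
    rw [Real.le_log_iff_exp_le (by positivity)]
    have : (3 : ℝ) ≤ n := by exact_mod_cast hn
    linarith [Real.exp_one_lt_three]
  rw [kOne, Real.sqrt_div zero_le_one, Real.sqrt_one, one_div_one_div]
  -- By convexity ((1 + s)/2)² ≤ (1 + s²)/2 with s² = b + 1, which is (b + 2)/2 ≤ 5b/2 for b > 1.
  refine Real.le_sqrt_of_sq_le ?_
  have h1 := Real.sq_sqrt (by linarith : 0 ≤ b + 1)
  have h2 := sq_nonneg (√(b + 1) - 1)
  have h3 : b * (5 / 2) * 1 ≤ b * (5 / 2) * Real.log n :=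
    mul_le_mul_of_nonneg_left hlog (by positivity)
  nlinarith

theorem le_coordinateBound {b R G γ α : ℝ} (hb : 1 < b) (hR : 0 < R) (hG : 0 ≤ G)
    (hα : 0 < α) {n : ℕ} (hn : 3 ≤ n) :
    2 * R ^ 2 * √(n + 1) / α + (G ^ 2 + γ ^ 2) * (α * √n * ((1 + √(b + 1)) / 2)) +
      γ * R * √n ≤ coordinateBound b R G γ α n := by
  have h1 : √((n : ℝ) + 1) ≤ √(kTwo b n * n + 1) := by
    refine Real.sqrt_le_sqrt ?_
    have := mul_le_mul_of_nonneg_right (one_le_kTwo hb n) (Nat.cast_nonneg (α := ℝ) n)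
    linarith
  have h2 : 2 * R ^ 2 * √((n : ℝ) + 1) / α ≤ 2 * R ^ 2 * √(kTwo b n * n + 1) / α := by gcongr
  have h3 := mul_le_mul_of_nonneg_left (le_one_div_sqrt_kOne hb hn)
    (by positivity : 0 ≤ (G ^ 2 + γ ^ 2) * (α * √(n : ℝ)))
  have h4 : 0 ≤ 4 * R * G * √(n : ℝ) := by positivity
  unfold coordinateBound
  rw [div_eq_mul_one_div (α * √(n : ℝ))]
  linarith

/-- The regret rate in the number of rounds. -/
noncomputable def rate (b : ℝ) (T : ℕ) : ℝ :=
  2 * √(T + 1) + (1 + √(b + 1)) / 2 * √T + √T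

theorem rate_isBigO (b : ℝ) : rate b =O[atTop] fun T : ℕ => (T : ℝ) ^ (1 / 2 : ℝ) := by
  refine IsBigO.of_bound (4 + (1 + √(b + 1)) / 2 + 1) ?_
  filter_upwards [eventually_ge_atTop 1] with T hT
  have hT' : (1 : ℝ) ≤ T := by exact_mod_cast hT
  rw [← Real.sqrt_eq_rpow, Real.norm_of_nonneg (Real.sqrt_nonneg _),
    Real.norm_of_nonneg (by unfold rate; positivity)]
  have h : √((T : ℝ) + 1) ≤ 2 * √T := by
    rw [Real.sqrt_le_left (by positivity), mul_pow, Real.sq_sqrt (by positivity)]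
    linarith
  unfold rate
  linarith

theorem rate_isLittleO (b : ℝ) {δ : ℝ} (hδ : 0 < δ) :
    rate b =o[atTop] fun T : ℕ => (T : ℝ) ^ (1 / 2 + δ) := by
  refine (rate_isBigO b).trans_isLittleO ?_
  have h1 : (fun x : ℝ => (1 : ℝ)) =o[atTop] fun x : ℝ => x ^ δ :=
    isLittleO_const_left.2 (Or.inr (tendsto_norm_atTop_atTop.comp (tendsto_rpow_atTop hδ)))
  have h2 := ((isBigO_refl (fun T : ℕ => (T : ℝ) ^ (1 / 2 : ℝ)) atTop).mul_isLittleO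
    (h1.comp_tendsto tendsto_natCast_atTop_atTop))
  refine h2.congr' (Eventually.of_forall fun T => mul_one _) ?_
  filter_upwards [eventually_ge_atTop 1] with T hT
  exact (Real.rpow_add (by exact_mod_cast hT) _ _).symm

/-- This α gives R²/α and (G² + γ²) α the common value R √(G² + γ²), which also dominates γR. -/
theorem bound_le_rate {b R G γ : ℝ} (hR : 0 < R) (hγ : 0 < γ) (T : ℕ) :
    2 * R ^ 2 * √(T + 1) / (R / √(G ^ 2 + γ ^ 2)) +
      (G ^ 2 + γ ^ 2) * (R / √(G ^ 2 + γ ^ 2) * √T * ((1 + √(b + 1)) / 2)) + γ * R * √T ≤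
    R * √(G ^ 2 + γ ^ 2) * rate b T := by
  have hS : 0 < √(G ^ 2 + γ ^ 2) := Real.sqrt_pos.2 (by positivity)
  have hsq : G ^ 2 + γ ^ 2 = √(G ^ 2 + γ ^ 2) ^ 2 := (Real.sq_sqrt (by positivity)).symm
  have hγS : γ ≤ √(G ^ 2 + γ ^ 2) := Real.le_sqrt_of_sq_le (by nlinarith [sq_nonneg G])
  set S := √(G ^ 2 + γ ^ 2)
  rw [hsq]
  have h1 : 2 * R ^ 2 * √((T : ℝ) + 1) / (R / S) = R * S * (2 * √((T : ℝ) + 1)) := by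
    field_simp
  have h2 : S ^ 2 * (R / S * √(T : ℝ) * ((1 + √(b + 1)) / 2)) =
      R * S * ((1 + √(b + 1)) / 2 * √(T : ℝ)) := by
    field_simp
  have h3 := mul_le_mul_of_nonneg_right hγS (by positivity : 0 ≤ R * √(T : ℝ))
  rw [h1, h2]
  unfold rate
  linarith

end OGDRand

theorem theorem3 (b : ℝ) (hb : 1 < b) :
    (∀ (d : ℕ) (R G γ α : ℝ), 0 < R → 0 ≤ G → 0 < γ → 0 < α →
      ∀ (ε : OGDRand.History d → Fin d → ℕ → ℝ)
        (f : OGDRand.History d → (Fin d → ℝ) → ℝ) (g : OGDRand.History d → Fin d → ℝ)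
        (T : ℕ) (n : Fin d → ℕ),
        OGDRand.IsResolutionSchedule b R γ α ε →
        OGDRand.IsAdversary b R G α ε f g T →
        (∀ h ∈ (OGDRand.play b R α ε g T).support, ∀ i, OGDRand.nonzeroCount g i h ≤ n i) →
        OGDRand.expectation (OGDRand.play b R α ε g T) (OGDRand.regret R f)
          ≤ ∑ i, OGDRand.coordinateBound b R G γ α (n i)) ∧
    (∃ φ : ℕ → ℝ,
      (∀ δ : ℝ, 0 < δ → φ =o[atTop] fun T : ℕ => (T : ℝ) ^ (1 / 2 + δ)) ∧
      ∀ (d : ℕ) (R G γ : ℝ), 0 < R → 0 ≤ G → 0 < γ →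
        ∀ (α : ℝ), α = R / √(G ^ 2 + γ ^ 2) →
        ∀ (ε : OGDRand.History d → Fin d → ℕ → ℝ)
          (f : OGDRand.History d → (Fin d → ℝ) → ℝ) (g : OGDRand.History d → Fin d → ℝ)
          (T : ℕ),
          OGDRand.IsResolutionSchedule b R γ α ε →
          OGDRand.IsAdversary b R G α ε f g T →
          OGDRand.expectation (OGDRand.play b R α ε g T) (OGDRand.regret R f)
            ≤ d * (R * √(G ^ 2 + γ ^ 2) * φ T)) := by
  open OGDRand in
  refine ⟨?_, rate b, fun δ hδ => rate_isLittleO b hδ, ?_⟩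
  · intro d R G γ α hR hG hγ hα ε f g T n hε hA hn
    refine expectation_regret_le_sum hR hA fun i => ?_
    -- The comparison of coefficients needs log n ≥ 1, hence n ≥ 3, and would fail at n = 1, where
    -- the second summand is 0. The trivial bound works up to 4, so the two ranges overlap.
    rcases le_or_gt (n i) 4 with h | h
    · obtain ⟨X, h1, h2⟩ := exists_linearRegret_bound_trivial hR hG hε i hA.gradientBound
        fun h hh => hn h hh i
      exact ⟨X, h1, h2.trans (le_coordinateBound_of_le_four hR hG hγ hα h)⟩
    · obtain ⟨X, h1, h2⟩ := exists_linearRegret_bound hb hR hα hγ hε i hA.gradientBound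
        fun h hh => hn h hh i
      exact ⟨X, h1, h2.trans (le_coordinateBound hb hR hG hα (by omega))⟩
  · intro d R G γ hR hG hγ α hαe ε f g T hε hA
    have hα : 0 < α := by
      rw [hαe]
      exact div_pos hR (Real.sqrt_pos.2 (by positivity))
    have key := expectation_regret_le_sum (B := fun _ => R * √(G ^ 2 + γ ^ 2) * rate b T) hR hA
      fun i => by
        obtain ⟨X, h1, h2⟩ := exists_linearRegret_bound hb hR hα hγ hε i hA.gradientBound
          fun h hh => nonzeroCount_le i hh
        refine ⟨X, h1, h2.trans ?_⟩
        rw [hαe]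
        exact bound_le_rate hR hγ T
    simpa using key
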